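/- **Setting.** Let $X$ solve $dX_t=b(X_t)\,dt+\sum_{j=1}^q\sigma_j(X_t)\,dW^j_t$, $X_0=x_0\in\mathbb R^d$, on $[0,T]$, $T>0$, where $W$ is a $q$-dimensional Brownian motion and $b,\sigma_j:\mathbb R^d\to\mathbb R^d$ are Lipschitz; let $P:\mathbb R^d\to\mathbb R$ be measurable. Let $\mathbf h=T/N_0$ with an integer $N_0\ge1$, and for $h=\mathbf h/n$, $n\ge 1$, let $X^h$ be the approximation of $X$ by a fixed one-step discretization scheme with step $h$: $X^h_{(k+1)h}$ is a measurable function, depending only on $h$, of $X^h_{kh}$ and of the increments $(W_{kh+s}-W_{kh})_{0\le s\le h}$ (for example the Euler or the Milstein scheme). Fix a refinement factor $M\ge2$, a number of levels $L\ge1$, rates $\alpha,\beta>0$ and $V_1>0$. Put $$Z_1=P(X_T^{\mathbf h}),\qquad Z_l=P(X_T^{\mathbf h/M^{l-1}})-P(X_T^{\mathbf h/M^{l-2}})\quad(l\ge2),$$ $$Y_1=Z_1,\qquad Y_l=(\mathbf h/M^{l-1})^{-\beta/2}Z_l\quad(l\ge2).$$ Let $(w_j)_{1\le j\le L}$ solve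 $\sum_{j=1}^L M^{-\alpha i(j-1)}w_j=\mathbf 1_{\{i=0\}}$, $0\le i<L$, and put $\widetilde W_l=\sum_{j=l}^Lw_j$. For $\beta>1$ let $\lambda=\sqrt{V_1/\mathrm{Var}(P(X_T))}$, $\underline C=(1+M^{\beta/2})/\sqrt{1+M^{-1}}$, $\overline C=(1+M^{\beta/2})\sqrt{1+M^{-1}}$, $$\Sigma=1+\lambda\mathbf h^{\beta/2}\Bigl(1+\overline C\,\frac{M^{(1-\beta)/2}}{1-M^{(1-\beta)/2}}\Bigr),\qquad k_1=\frac1{\Sigma\,\mathrm{Var}(P(X_T))\,(1+\lambda\mathbf h^{\beta/2})},$$ $$k_l=\frac{\mathbf h^{\beta/2}}{\Sigma\sqrt{\mathrm{Var}(P(X_T))V_1}\;\underline C}\,M^{\frac{1+\beta}2(l-1)}\,|\widetilde W_l|\,\mathbf h^{-\beta}\quad(2\le l\le L).$$ Put $Q_l=k_lZ_l^2$ if $\beta>1$ and $Q_l=Y_l^2$ if $\beta\le1$, $\mathcal J^+(x,\theta)=e^{-\langle x,\theta\rangle+\frac12|\theta|^2T}$, and $$\mathbf v_l(\theta)=\mathbb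 E\bigl[Q_l\,\mathcal J^+(W_T,\theta)\bigr],\qquad G_l(\theta)=(\theta T-W_T)\,Q_l\,\mathcal J^+(W_T,\theta),\qquad\theta\in\mathbb R^q.$$ **Assumptions.** Fix $l\in\{1,\dots,L\}$. (i) The strong error bound $\mathbb E|P(X_T^h)-P(X_T)|^r\le V^{(r)}h^{\beta r/2}$ for all $h=\mathbf h/n$, $n\ge1$, holds for $r=2$ with $V^{(2)}=V_1$, and for $r=p$ with some $p>4$ and some constant $V^{(p)}>0$. (ii) If $l=1$, then $\mathbb E|Z_1|^p<\infty$. (iii) $\mathbb P(Z_l\ne0)>0$. (iv) If $\beta>1$, then $\mathbb E|P(X_T)|^2<\infty$ and $\mathrm{Var}(P(X_T))>0$, and, if moreover $l\ge2$, $\widetilde W_l\neq0$. **Algorithm.** Let $\Theta\subset\mathbb R^q$ be compact and convex and $\theta_l^0\in\Theta$. Let $(\gamma_n)_{n\ge1}$ be a non-increasing sequence of positive reals with $\sum\gamma_n=\infty$ and $\sum\gamma_n^2<\infty$, and let $W^{(1)},W^{(2)},\dots$ be independent copies of $W$. With $G_l^{(n)}(\theta)$ denoting $G_l(\theta)$ computed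 from the path $W^{(n)}$ in place of $W$, and $\mathrm{Proj}_\Theta$ the nearest-point projection onto $\Theta$, define $$\theta_l^{n+1}=\mathrm{Proj}_\Theta\bigl[\theta_l^n-\gamma_{n+1}G_l^{(n+1)}(\theta_l^n)\bigr],\qquad n\ge0.$$ **Theorem.** If $\theta_l^*$ minimizes $\mathbf v_l$ over $\mathbb R^q$, $\nabla\mathbf v_l(\theta_l^*)=0$ and $\theta_l^*\in\Theta$, then $\theta_l^k\to\theta_l^*$ almost surely as $k\to\infty$. -/

import Mathlib

open MeasureTheory ProbabilityTheory Filter Topology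
open scoped NNReal ENNReal

namespace ML2R

/-- `ℝⁿ` with the Euclidean norm. -/
abbrev E (n : ℕ) : Type := EuclideanSpace ℝ (Fin n)

/-! ### Brownian motion and the stochastic differential equation -/

/-- `B` is a standard `q`-dimensional Brownian motion with respect to the filtration `ℱ`. -/
structure IsBrownianMotion {Ω : Type*} {m : MeasurableSpace Ω} {q : ℕ} (μ : Measure Ω)
    (ℱ : Filtration ℝ≥0 m) (B : ℝ≥0 → Ω → E q) : Prop where
  adapted : StronglyAdapted ℱ B
  start : ∀ᵐ ω ∂μ, B 0 ω = 0
  indep : ∀ s t : ℝ≥0, s ≤ t →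
    Indep (ℱ s) (MeasurableSpace.comap (fun ω => B t ω - B s ω) inferInstance) μ
  law : ∀ s t : ℝ≥0, s ≤ t →
    μ.map (fun ω => B t ω - B s ω) =
      (stdGaussian (E q)).map (fun z => Real.sqrt ((t : ℝ) - s) • z)
  cont : ∀ᵐ ω ∂μ, Continuous (fun t => B t ω)

/-- The matrix-vector product `σ(x) y = ∑ⱼ yⱼ σⱼ(x)`, where the `σⱼ` are the columns of `σ`. -/
noncomputable def diffusionApply {d q : ℕ} (σ : Fin q → E d → E d) (x : E d) (y : E q) : E d :=
  ∑ j, y j • σ j x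

/-- `I` is the Itô integral `∑ⱼ ∫₀ᵗ σⱼ(X_s) dBʲ_s` of the continuous adapted process `σ(X)`:
the limit in probability of the left-point Riemann sums over the uniform partitions of `[0, t]`. -/
def IsItoIntegral {Ω : Type*} {m : MeasurableSpace Ω} {d q : ℕ} (μ : Measure Ω)
    (σ : Fin q → E d → E d) (X : ℝ≥0 → Ω → E d) (B : ℝ≥0 → Ω → E q) (t : ℝ≥0)
    (I : Ω → E d) : Prop :=
  TendstoInMeasure μ
    (fun (n : ℕ) ω => ∑ i ∈ Finset.range n,
      diffusionApply σ (X (t * i / n) ω) (B (t * (i + 1) / n) ω - B (t * i / n) ω))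
    atTop I

/-- `X` is a solution on `[0, T]` of `dX = b(X) dt + ∑ⱼ σⱼ(X) dBʲ`, `X₀ = x₀`. -/
structure IsSDESolution {Ω : Type*} {m : MeasurableSpace Ω} {d q : ℕ} (μ : Measure Ω)
    (ℱ : Filtration ℝ≥0 m) (b : E d → E d) (σ : Fin q → E d → E d) (x₀ : E d) (T : ℝ≥0)
    (B : ℝ≥0 → Ω → E q) (X : ℝ≥0 → Ω → E d) : Prop where
  adapted : StronglyAdapted ℱ X
  cont : ∀ᵐ ω ∂μ, Continuous (fun t => X t ω)
  eqn : ∀ t : ℝ≥0, t ≤ T → IsItoIntegral μ σ X B t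
    (fun ω => X t ω - x₀ - ∫ s in (0 : ℝ)..t, b (X s.toNNReal ω))

/-! ### The multilevel setting -/

/-- The data: coefficients `b, σⱼ` and initial value `x₀` of the equation, horizon `T`,
payoff `P`, one-step map `step` of the discretization scheme, refinement factor `M`,
number `N₀` of time steps on the coarsest level (so `𝐡 = T / N₀`), number of levels `L`,
weak and strong error rates `α`, `β`, and strong error constant `V₁`.

`step h x w` is the value after one time step of length `h` from the state `x`, when the driving
Brownian path over that step has the increments `w s`, `0 ≤ s ≤ h`, since the start of the step.
Euler's scheme is `step h x w = x + h b(x) + σ(x) w(h)`; Milstein's scheme adds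
`∑ᵢⱼ Dσⱼ(x)[σᵢ(x)] ∫₀ʰ wᵢ dwʲ`, which is `σ'(x) σ(x) (w(h)² - h) / 2` in dimension one. -/
structure Setting (d q : ℕ) where
  b : E d → E d
  σ : Fin q → E d → E d
  x₀ : E d
  T : ℝ≥0
  P : E d → ℝ
  step : ℝ≥0 → E d → (ℝ≥0 → E q) → E d
  M : ℕ
  N₀ : ℕ
  L : ℕ
  α : ℝ
  β : ℝ
  V₁ : ℝ

namespace Setting

variable {d q : ℕ} (A : Setting d q)

/-- Standing assumptions on the data. -/
structure Admissible : Prop where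
  lipschitz : ∃ K : ℝ, 0 < K ∧ ∀ x y : E d,
    ‖A.b x - A.b y‖ + ∑ j, ‖A.σ j x - A.σ j y‖ ≤ K * ‖x - y‖
  T_pos : 0 < A.T
  P_meas : Measurable A.P
  step_meas : ∀ h : ℝ≥0, Measurable (fun z : E d × (ℝ≥0 → E q) => A.step h z.1 z.2)
  two_le_M : 2 ≤ A.M
  N₀_pos : 0 < A.N₀
  α_pos : 0 < A.α
  β_pos : 0 < A.β
  V₁_pos : 0 < A.V₁

/-- The coarsest step size `𝐡`. -/
noncomputable def bigh : ℝ := (A.T : ℝ) / A.N₀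

/-- The state of the scheme with step size `h` after `k` steps, driven by the path `w`. -/
def state (h : ℝ≥0) (w : ℝ≥0 → E q) : ℕ → E d
  | 0 => A.x₀
  | k + 1 => A.step h (state h w k) (fun s => w (k * h + min s h) - w (k * h))

/-- `P(X_T^{𝐡/n})`: the payoff of the scheme with step size `𝐡 / n`, i.e. with `N₀ n` steps
on `[0, T]`, driven by the path `w`. -/
noncomputable def approxPayoff (n : ℕ) (w : ℝ≥0 → E q) : ℝ :=
  A.P (A.state (A.T / ((A.N₀ * n : ℕ) : ℝ≥0)) w (A.N₀ * n))

/-- `Z₁ = P(X_T^𝐡)` and `Z_l = P(X_T^{𝐡/M^{l-1}}) - P(X_T^{𝐡/M^{l-2}})` for `l ≥ 2`. -/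
noncomputable def Z (l : ℕ) (w : ℝ≥0 → E q) : ℝ :=
  if l = 1 then A.approxPayoff 1 w
  else A.approxPayoff (A.M ^ (l - 1)) w - A.approxPayoff (A.M ^ (l - 2)) w

/-- `Y₁ = Z₁` and `Y_l = (𝐡/M^{l-1})^{-β/2} Z_l` for `l ≥ 2`. -/
noncomputable def Y (l : ℕ) (w : ℝ≥0 → E q) : ℝ :=
  if l = 1 then A.Z 1 w
  else (A.bigh / (A.M : ℝ) ^ (l - 1)) ^ (-A.β / 2) * A.Z l w

/-- The Vandermonde matrix with rows `n_1^{-α i}, …, n_L^{-α i}` (`0 ≤ i < L`), `n_j = M^{j-1}`. -/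
noncomputable def vander : Matrix (Fin A.L) (Fin A.L) ℝ :=
  fun i j => ((A.M : ℝ) ^ (j : ℕ)) ^ (-(A.α * (i : ℕ)))

/-- The solution `w` of `V w = e₁`. -/
noncomputable def smallw : Fin A.L → ℝ :=
  A.vander⁻¹.mulVec (fun i => if (i : ℕ) = 0 then 1 else 0)

/-- The weight `W̃_l = ∑_{j = l}^{L} w_j` (the index `j` here counts from zero). -/
noncomputable def bigW (l : ℕ) : ℝ :=
  ∑ j : Fin A.L, if l ≤ (j : ℕ) + 1 then A.smallw j else 0

/-- `λ = √(V₁ / Var P(X_T))`; `varP` stands for `Var P(X_T)`, here and below. -/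
noncomputable def lam (varP : ℝ) : ℝ := Real.sqrt (A.V₁ / varP)

noncomputable def CLow : ℝ :=
  (1 + (A.M : ℝ) ^ (A.β / 2)) / Real.sqrt (1 + (A.M : ℝ)⁻¹)

noncomputable def CUp : ℝ :=
  (1 + (A.M : ℝ) ^ (A.β / 2)) * Real.sqrt (1 + (A.M : ℝ)⁻¹)

/-- The constant `Σ` of the central limit theorem for `β > 1`. -/
noncomputable def bigSigma (varP : ℝ) : ℝ :=
  1 + A.lam varP * A.bigh ^ (A.β / 2) *
    (1 + A.CUp * ((A.M : ℝ) ^ ((1 - A.β) / 2) / (1 - (A.M : ℝ) ^ ((1 - A.β) / 2))))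

/-- The coefficient at level one, for `β > 1`. -/
noncomputable def kOne (varP : ℝ) : ℝ :=
  1 / A.bigSigma varP * (1 / (varP * (1 + A.lam varP * A.bigh ^ (A.β / 2))))

/-- The level-independent factor of the coefficients at the levels `l ≥ 2`, for `β > 1`. -/
noncomputable def kTwo (varP : ℝ) : ℝ :=
  A.bigh ^ (A.β / 2) / (A.bigSigma varP * Real.sqrt (varP * A.V₁) * A.CLow)

/-- The coefficient `k_l` at level `l`, for `β > 1`. -/
noncomputable def k (varP : ℝ) (l : ℕ) : ℝ :=
  if l = 1 then A.kOne varP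
  else A.kTwo varP * (A.M : ℝ) ^ ((1 + A.β) / 2 * ((l : ℝ) - 1)) * |A.bigW l| * A.bigh ^ (-A.β)

/-- `k_l Z_l²` if `β > 1`, and `Y_l²` if `β ≤ 1`. -/
noncomputable def weightedSq (varP : ℝ) (l : ℕ) (w : ℝ≥0 → E q) : ℝ :=
  if 1 < A.β then A.k varP l * A.Z l w ^ 2 else A.Y l w ^ 2

/-- `J⁺(w_T, θ) = exp(-⟨θ, w_T⟩ + |θ|² T / 2)`. -/
noncomputable def Jplus (x θ : E q) : ℝ :=
  Real.exp (-(inner ℝ θ x) + 1 / 2 * ‖θ‖ ^ 2 * A.T)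

/-- The level-`l` variance functional `v_l(θ)`; `B` is the driving Brownian motion. -/
noncomputable def v {Ω : Type*} {m : MeasurableSpace Ω} (μ : Measure Ω) (B : ℝ≥0 → Ω → E q)
    (varP : ℝ) (l : ℕ) (θ : E q) : ℝ :=
  ∫ ω, A.weightedSq varP l (fun t => B t ω) * A.Jplus (B A.T ω) θ ∂μ

/-- The gradient estimator `G_l` at `θ`, computed from the Brownian path `w`. -/
noncomputable def G (varP : ℝ) (l : ℕ) (θ : E q) (w : ℝ≥0 → E q) : E q :=
  (A.weightedSq varP l w * A.Jplus (w A.T) θ) • ((A.T : ℝ) • θ - w A.T)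

/-- The `Lᵖ`-strong error assumption with rate `β` and constant `V`:
`E|P(X_T^h) - P(X_T)|ᵖ ≤ V h^{βp/2}` for all `h = 𝐡/n`, `n ≥ 1`. -/
def StrongError {Ω : Type*} {m : MeasurableSpace Ω} (μ : Measure Ω) (B : ℝ≥0 → Ω → E q)
    (XT : Ω → E d) (p V : ℝ) : Prop :=
  ∀ n : ℕ, 1 ≤ n →
    ∫⁻ ω, ENNReal.ofReal (|A.approxPayoff n (fun t => B t ω) - A.P (XT ω)| ^ p) ∂μ ≤
      ENNReal.ofReal (V * (A.bigh / n) ^ (A.β * p / 2))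

end Setting

/-- `y` is the projection of `x` onto `Θ`: the nearest point of `Θ` (unique if `Θ` is convex). -/
def IsProj {q : ℕ} (Θ : Set (E q)) (x y : E q) : Prop :=
  y ∈ Θ ∧ ∀ z ∈ Θ, ‖x - y‖ ≤ ‖x - z‖

end ML2R

/-! The weight is `Q_l = κ Z_l²` with `κ > 0`, and `θ ↦ J⁺(x, θ)` is the exponential of a quadratic.
Moving from `θ` to `θ'` multiplies it by `exp(⟨θ' - θ, Tθ - x⟩ + T|θ' - θ|²/2)`. Bounding this
factor below by `1 + u`, with `u` the exponent, then multiplying by `Q_l` and integrating at `θ' =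
θ*` gives `v(θ)(1 + T|θ - θ*|²/2) - ⟨θ - θ*, E G(θ)⟩ ≤ v(θ*)`. Since `v(θ) ≥ v(θ*)`, it follows that
`⟨θ - θ*, E G(θ)⟩ ≥ c|θ - θ*|²` with `c = T v(θ*)/2`. This `c` is positive because `Z_l` is not
almost surely zero. No differentiation under the integral is needed.

On `Θ` the estimator has a square integrable envelope, by Hölder (`p > 4`) and Gaussian exponential
moments. As the projection is nonexpansive and fixes `θ*`, the squared distances to `θ*` satisfy
`E[a_{n+1} | past] ≤ (1 - 2cγ)a_n + Kγ²`, where `γ` is the current step size. Submartingale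
convergence yields an almost sure limit, and `∑ γ = ∞` forces it to vanish.

The carrying lemmas are `Jplus_add_inner_le`, `memLp_Z_sq_mul_exp`,
`ae_tendsto_zero_of_setIntegral_succ_le` and `ae_tendsto_projected_robbinsMonro`. -/

namespace ML2R

/-! ### Nearest-point projection onto a convex set -/

section Projection

variable {q : ℕ} {Θ : Set (E q)}

theorem IsProj.norm_eq_iInf {x y : E q} (h : IsProj Θ x y) :
    ‖x - y‖ = ⨅ w : Θ, ‖x - w‖ := by
  have : Nonempty Θ := ⟨⟨y, h.1⟩⟩
  refine le_antisymm (le_ciInf fun w => h.2 w w.2) ?_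
  exact ciInf_le (f := fun w : Θ => ‖x - w‖) ⟨0, by rintro _ ⟨w, rfl⟩; positivity⟩ ⟨y, h.1⟩

theorem IsProj.inner_le_zero (hΘ : Convex ℝ Θ) {x y z : E q} (h : IsProj Θ x y) (hz : z ∈ Θ) :
    inner ℝ (x - y) (z - y) ≤ 0 :=
  (norm_eq_iInf_iff_real_inner_le_zero hΘ h.1).1 h.norm_eq_iInf z hz

/-- The projection onto a convex set is nonexpansive. -/
theorem IsProj.norm_sub_le (hΘ : Convex ℝ Θ) {x y x' y' : E q} (h : IsProj Θ x y)
    (h' : IsProj Θ x' y') : ‖y - y'‖ ≤ ‖x - x'‖ := by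
  have h1 := h.inner_le_zero hΘ h'.1
  have h2 := h'.inner_le_zero hΘ h.1
  -- The sum of the two variational inequalities; Cauchy–Schwarz then gives the bound after division
  -- by `‖y - y'‖`.
  have h3 : inner ℝ (y - y') (y - y') ≤ inner ℝ (x - x') (y - y') := by
    simp only [inner_sub_left, inner_sub_right] at *
    linarith
  have h4 := h3.trans (real_inner_le_norm _ _)
  rw [real_inner_self_eq_norm_mul_norm] at h4
  rcases (norm_nonneg (y - y')).eq_or_lt with h0 | h0
  · rw [← h0]; positivity
  · exact le_of_mul_le_mul_right h4 h0

theorem isProj_self {x : E q} (hx : x ∈ Θ) : IsProj Θ x x :=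
  ⟨hx, fun z _ => by simp⟩

/-- The iterates are given only through the relation `IsProj`; this turns them into measurable
functions of the past. Nonexpansiveness gives both continuity of `π` and uniqueness of the
projection. -/
theorem exists_measurable_isProj (hc : IsCompact Θ) (hΘ : Convex ℝ Θ) (hne : Θ.Nonempty) :
    ∃ π : E q → E q, Measurable π ∧ ∀ x y, IsProj Θ x y → y = π x := by
  have hex : ∀ x, ∃ y, IsProj Θ x y := fun x => by
    obtain ⟨y, hy, hmin⟩ := hc.exists_isMinOn hne
      (f := fun y => ‖x - y‖) (by fun_prop)
    exact ⟨y, hy, fun z hz => hmin hz⟩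
  choose π hπ using hex
  refine ⟨π, ?_, fun x y hy => ?_⟩
  · have : LipschitzWith 1 π := LipschitzWith.of_dist_le_mul fun x y => by
      simpa [dist_eq_norm] using (hπ x).norm_sub_le hΘ (hπ y)
    exact this.continuous.measurable
  · have := hy.norm_sub_le hΘ (hπ x)
    rw [sub_self, norm_zero] at this
    exact sub_eq_zero.1 (norm_le_zero_iff.1 this)

end Projection

/-! ### Independence of the past from the next path -/

section Independence

variable {Ω S R : Type*} {mΩ : MeasurableSpace Ω} [mS : MeasurableSpace S] [MeasurableSpace R]

/-- Freezing: the joint law is a product, so Tonelli integrates out `W` with `X` held fixed. Values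
in `ℝ≥0∞` spare any integrability condition. -/
theorem lintegral_comp_of_indepFun {μ : Measure Ω} [IsProbabilityMeasure μ] {X : Ω → R}
    {W : Ω → S} (hX : Measurable X) (hW : Measurable W) (hXW : IndepFun X W μ)
    {g : R → S → ℝ≥0∞} (hg : Measurable (Function.uncurry g)) :
    ∫⁻ ω, g (X ω) (W ω) ∂μ = ∫⁻ ω, ∫⁻ w, g (X ω) w ∂(μ.map W) ∂μ := by
  have : IsProbabilityMeasure (μ.map W) := Measure.isProbabilityMeasure_map hW.aemeasurable
  have h1 := (indepFun_iff_map_prod_eq_prod_map_map hX.aemeasurable hW.aemeasurable).1 hXW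
  have h2 : ∫⁻ ω, g (X ω) (W ω) ∂μ
      = ∫⁻ z, Function.uncurry g z ∂(μ.map fun ω => (X ω, W ω)) :=
    (lintegral_map hg (hX.prodMk hW)).symm
  rw [h2, h1, lintegral_prod _ hg.aemeasurable, lintegral_map hg.lintegral_prod_right' hX]
  rfl

/-- The filtration generated by a sequence of random elements of a measurable space. -/
def pastFiltration (W : ℕ → Ω → S) (hW : ∀ n, Measurable (W n)) : Filtration ℕ mΩ where
  seq n := ⨆ i ∈ Set.Iic n, mS.comap (W i)
  mono' _ _ hnm := biSup_mono fun _ hi => le_trans hi hnm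
  le' _ := iSup₂_le fun i _ => (hW i).comap_le

theorem measurable_pastFiltration {W : ℕ → Ω → S} (hW : ∀ n, Measurable (W n)) {i n : ℕ}
    (hi : i ≤ n) : Measurable[pastFiltration W hW n] (W i) := by
  rw [measurable_iff_comap_le]
  exact le_iSup₂_of_le (f := fun j (_ : j ∈ Set.Iic n) => mS.comap (W j)) i hi le_rfl

theorem indepFun_of_measurable_pastFiltration {μ : Measure Ω} {W : ℕ → Ω → S}
    (hW : ∀ n, Measurable (W n)) (hind : iIndepFun W μ) {n : ℕ} {X : Ω → R}
    (hX : Measurable[pastFiltration W hW n] X) : IndepFun X (W (n + 1)) μ := by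
  have h := indep_iSup_of_disjoint (S := Set.Iic n) (T := {n + 1})
    (fun i => (hW i).comap_le) hind (by simp)
  rw [IndepFun_iff_Indep]
  refine indep_of_indep_of_le_left (indep_of_indep_of_le_right h ?_) hX.comap_le
  simp

end Independence

/-! ### Projected Robbins–Monro convergence -/

section RobbinsMonro

variable {q : ℕ} {S Ω : Type*} [MeasurableSpace S] {mΩ : MeasurableSpace Ω}

/-- One step before projection: in the expanded square, `hc` controls the cross term and `hK` the
quadratic one. The first conjunct allows `ENNReal.ofReal` to be removed later. -/
theorem lintegral_norm_sub_smul_sq_le {ν : Measure S} [IsProbabilityMeasure ν] {F : S → E q}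
    (hF : MemLp F 2 ν) {K c : ℝ} (hK : ∫ w, ‖F w‖ ^ 2 ∂ν ≤ K) {x : E q}
    (hc : c * ‖x‖ ^ 2 ≤ inner ℝ x (∫ w, F w ∂ν)) {r : ℝ} (hr : 0 < r) :
    0 ≤ ‖x‖ ^ 2 - 2 * c * r * ‖x‖ ^ 2 + K * r ^ 2 ∧
    ∫⁻ w, ENNReal.ofReal (‖x - r • F w‖ ^ 2) ∂ν ≤
      ENNReal.ofReal (‖x‖ ^ 2 - 2 * c * r * ‖x‖ ^ 2 + K * r ^ 2) := by
  have hi : Integrable F ν := hF.integrable (by norm_num)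
  have hi2 : Integrable (fun w => ‖F w‖ ^ 2) ν := hF.norm.integrable_sq
  have hi3 : Integrable (fun w => inner ℝ x (F w)) ν := hi.const_inner x
  have hexp : ∀ w, ‖x - r • F w‖ ^ 2
      = ‖x‖ ^ 2 - 2 * r * inner ℝ x (F w) + r ^ 2 * ‖F w‖ ^ 2 := fun w => by
    rw [norm_sub_sq_real, inner_smul_right, norm_smul, mul_pow, Real.norm_eq_abs, sq_abs]
    ring
  have hi5 : Integrable (fun w => ‖x‖ ^ 2 - 2 * r * inner ℝ x (F w)) ν :=
    (integrable_const _).sub (hi3.const_mul _)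
  have hi4 : Integrable (fun w => ‖x - r • F w‖ ^ 2) ν := by
    simp_rw [hexp]
    exact hi5.add (hi2.const_mul _)
  have hle : ∫ w, ‖x - r • F w‖ ^ 2 ∂ν ≤ ‖x‖ ^ 2 - 2 * c * r * ‖x‖ ^ 2 + K * r ^ 2 := by
    simp_rw [hexp]
    rw [integral_add hi5 (hi2.const_mul _), integral_sub (integrable_const _) (hi3.const_mul _),
      integral_const_mul, integral_const_mul, integral_inner hi]
    simp only [integral_const, probReal_univ, one_smul]
    nlinarith [mul_le_mul_of_nonneg_left hc hr.le, mul_le_mul_of_nonneg_left hK (sq_nonneg r)]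
  refine ⟨(integral_nonneg fun w => by positivity).trans hle, ?_⟩
  rw [← ofReal_integral_eq_lintegral_ofReal hi4 (ae_of_all _ fun w => by positivity)]
  exact ENNReal.ofReal_le_ofReal hle

/-- A nonnegative bounded adapted sequence whose conditional expectations decrease by
`c γₙ₊₁ aₙ`, up to summable errors, tends to zero almost surely when `∑ γₙ = ∞`. -/
theorem ae_tendsto_zero_of_setIntegral_succ_le {μ : Measure Ω} [IsProbabilityMeasure μ]
    {ℱ : Filtration ℕ mΩ} {a : ℕ → Ω → ℝ} (ha : StronglyAdapted ℱ a)
    (ha0 : ∀ n ω, 0 ≤ a n ω) {C : ℝ} (haC : ∀ n ω, a n ω ≤ C)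
    {γ ε : ℕ → ℝ} (hγ : ∀ n, 0 < γ n) (hε : ∀ n, 0 ≤ ε n)
    (hγsum : ¬ Summable γ) (hεsum : Summable ε) {c : ℝ} (hc : 0 < c)
    (hstep : ∀ n s, MeasurableSet[ℱ n] s →
      ∫ ω in s, a (n + 1) ω ∂μ ≤ ∫ ω in s, (a n ω - c * γ n * a n ω + ε n) ∂μ) :
    ∀ᵐ ω ∂μ, Tendsto (fun n => a n ω) atTop (𝓝 0) := by
  have hsm : ∀ n, StronglyMeasurable (a n) := fun n => (ha n).mono (ℱ.le n)
  have hint : ∀ n, Integrable (a n) μ := fun n =>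
    Integrable.of_bound (hsm n).aestronglyMeasurable C
      (ae_of_all _ fun ω => by rw [Real.norm_of_nonneg (ha0 n ω)]; exact haC n ω)
  set s : ℕ → ℝ := fun n => ∑ k ∈ Finset.range n, ε k with hs
  have hs0 : ∀ n, 0 ≤ s n := fun n => Finset.sum_nonneg fun k _ => hε k
  have hsle : ∀ n, s n ≤ ∑' k, ε k := fun n => hεsum.sum_le_tsum _ fun k _ => hε k
  -- Dropping the decrease `c γₙ aₙ` leaves an increment of at most `εₙ`, which the partial sums `s`
  -- compensate.
  have hsuper : Submartingale (fun n ω => s n - a n ω) ℱ μ := by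
    refine submartingale_of_setIntegral_le_succ (fun n => (stronglyMeasurable_const.sub (ha n)))
      (fun n => (integrable_const _).sub (hint n)) fun n A hA => ?_
    have h1 := hstep n A hA
    have h2 : ∫ ω in A, (a n ω - c * γ n * a n ω + ε n) ∂μ ≤ ∫ ω in A, (a n ω + ε n) ∂μ := by
      refine integral_mono ?_ ?_ fun ω => ?_
      · exact (((hint n).sub ((hint n).const_mul _)).add (integrable_const _)).integrableOn
      · exact ((hint n).add (integrable_const _)).integrableOn
      · have := mul_nonneg (mul_pos hc (hγ n)).le (ha0 n ω)
        dsimp only; linarith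
    have i1 := (hint n).integrableOn (s := A)
    have i2 := (hint (n + 1)).integrableOn (s := A)
    rw [integral_add i1 (integrable_const _)] at h2
    rw [integral_sub (integrable_const _) i1, integral_sub (integrable_const _) i2]
    have h3 : ∫ _ω in A, s (n + 1) ∂μ = ∫ _ω in A, s n ∂μ + ∫ _ω in A, ε n ∂μ := by
      rw [← integral_add (integrable_const _) (integrable_const _)]
      simp [hs, Finset.sum_range_succ]
    linarith
  have hC0 : 0 ≤ C := by
    obtain ⟨ω⟩ : Nonempty Ω := nonempty_of_isProbabilityMeasure μ
    exact (ha0 0 ω).trans (haC 0 ω)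
  have hbdd : ∀ n, eLpNorm (fun ω => s n - a n ω) 1 μ ≤ (((∑' k, ε k) + C).toNNReal : ℝ≥0) := by
    intro n
    refine (eLpNorm_le_of_ae_bound (C := (∑' k, ε k) + C) (ae_of_all _ fun ω => ?_)).trans ?_
    · rw [Real.norm_eq_abs, abs_le]
      constructor <;> linarith [hs0 n, hsle n, ha0 n ω, haC n ω, hs0 0, hsle 0]
    · simp [ENNReal.ofReal]
  have hconv : ∀ᵐ ω ∂μ, ∃ x, Tendsto (fun n => a n ω) atTop (𝓝 x) := by
    filter_upwards [hsuper.exists_ae_tendsto_of_bdd hbdd] with ω ⟨x, hx⟩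
    exact ⟨_, (hεsum.hasSum.tendsto_sum_nat.sub hx).congr fun n => by simp [hs]⟩
  obtain ⟨f, hf, hlim⟩ := exists_stronglyMeasurable_limit_of_tendsto_ae
    (fun n => (hsm n).aestronglyMeasurable) hconv
  have hf0 : 0 ≤ᵐ[μ] f := by
    filter_upwards [hlim] with ω h
    exact ge_of_tendsto' h fun n => ha0 n ω
  have hfint : Integrable f μ := by
    refine Integrable.of_bound hf.aestronglyMeasurable C ?_
    filter_upwards [hlim, hf0] with ω h h0
    rw [Real.norm_of_nonneg h0]
    exact le_of_tendsto' h fun n => haC n ω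
  have hE : Tendsto (fun n => ∫ ω, a n ω ∂μ) atTop (𝓝 (∫ ω, f ω ∂μ)) :=
    tendsto_integral_of_dominated_convergence (fun _ => C)
      (fun n => (hsm n).aestronglyMeasurable) (integrable_const _)
      (fun n => ae_of_all _ fun ω => by rw [Real.norm_of_nonneg (ha0 n ω)]; exact haC n ω) hlim
  have hEstep : ∀ n, c * γ n * ∫ ω, a n ω ∂μ
      ≤ ∫ ω, a n ω ∂μ - ∫ ω, a (n + 1) ω ∂μ + ε n := fun n => by
    have h := hstep n Set.univ MeasurableSet.univ
    simp only [Measure.restrict_univ] at h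
    have hi : Integrable (fun ω => a n ω - c * γ n * a n ω) μ :=
      (hint n).sub ((hint n).const_mul _)
    rw [integral_add hi (integrable_const _),
      integral_sub (hint n) ((hint n).const_mul _), integral_const_mul] at h
    simp only [integral_const, probReal_univ, one_smul] at h
    linarith
  -- Telescoping the expected decrease bounds `∑ c γₙ E aₙ`.
  have hEnn : ∀ n, 0 ≤ ∫ ω, a n ω ∂μ := fun n => integral_nonneg (ha0 n)
  have hsummable : Summable (fun n => c * γ n * ∫ ω, a n ω ∂μ) := by
    refine summable_of_sum_range_le (c := ∫ ω, a 0 ω ∂μ + ∑' k, ε k)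
      (fun n => mul_nonneg (mul_pos hc (hγ n)).le (hEnn n)) fun n => ?_
    have h1 := Finset.sum_le_sum fun k (_ : k ∈ Finset.range n) => hEstep k
    rw [Finset.sum_add_distrib, Finset.sum_range_sub'] at h1
    linarith [hEnn n, hsle n]
  -- If `E f = δ > 0`, then eventually `E aₙ > δ/2`, and the summability just shown would make `∑
  -- γₙ` converge.
  have hf_zero : ∫ ω, f ω ∂μ = 0 := by
    by_contra hne
    have hpos : 0 < ∫ ω, f ω ∂μ := lt_of_le_of_ne (integral_nonneg_of_ae hf0) (Ne.symm hne)
    set δ := ∫ ω, f ω ∂μ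
    obtain ⟨N, hN⟩ := eventually_atTop.1 (hE.eventually (lt_mem_nhds (half_lt_self hpos)))
    have h1 : Summable (fun n => c * (δ / 2) * γ (n + N)) := by
      refine Summable.of_nonneg_of_le (fun n => ?_) (fun n => ?_)
        ((summable_nat_add_iff N).2 hsummable)
      · have := hγ (n + N); positivity
      · have := mul_le_mul_of_nonneg_left (hN (n + N) (by omega)).le (mul_pos hc (hγ (n + N))).le
        linarith
    rw [summable_mul_left_iff (by positivity), summable_nat_add_iff N] at h1
    exact hγsum h1
  have hfz := (integral_eq_zero_iff_of_nonneg_ae hf0 hfint).1 hf_zero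
  filter_upwards [hlim, hfz] with ω h1 h2
  rwa [h2] at h1

/-- Convergence of the projected Robbins-Monro algorithm towards a point of the constraint set
at which the mean field is strongly monotone. -/
theorem ae_tendsto_projected_robbinsMonro {ν : Measure S} [IsProbabilityMeasure ν]
    {G : E q → S → E q} (hG : Measurable (Function.uncurry G))
    {Θ : Set (E q)} (hΘcompact : IsCompact Θ) (hΘconvex : Convex ℝ Θ)
    {θstar : E q} (hθstar : θstar ∈ Θ) (hG2 : ∀ ϑ ∈ Θ, MemLp (G ϑ) 2 ν)
    {K : ℝ} (hK : ∀ ϑ ∈ Θ, ∫ w, ‖G ϑ w‖ ^ 2 ∂ν ≤ K) {c : ℝ} (hc : 0 < c)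
    (hmono : ∀ ϑ ∈ Θ, c * ‖ϑ - θstar‖ ^ 2 ≤ inner ℝ (ϑ - θstar) (∫ w, G ϑ w ∂ν))
    {μ : Measure Ω} [IsProbabilityMeasure μ] {W : ℕ → Ω → S} (hW : ∀ n, Measurable (W n))
    (hlaw : ∀ n, μ.map (W n) = ν) (hind : iIndepFun W μ)
    {γ : ℕ → ℝ} (hγpos : ∀ n, 0 < γ n) (hγsum : ¬ Summable γ)
    (hγsq : Summable (fun n => γ n ^ 2))
    {θ : ℕ → Ω → E q} {θ₀ : E q} (hθ₀ : θ₀ ∈ Θ) (hθzero : ∀ ω, θ 0 ω = θ₀)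
    (hθsucc : ∀ n ω, IsProj Θ (θ n ω - γ n • G (θ n ω) (W (n + 1) ω)) (θ (n + 1) ω)) :
    ∀ᵐ ω ∂μ, Tendsto (fun n => θ n ω) atTop (𝓝 θstar) := by
  have hmem : ∀ n ω, θ n ω ∈ Θ := by
    rintro (_ | n) ω
    · rw [hθzero]; exact hθ₀
    · exact (hθsucc n ω).1
  obtain ⟨π, hπ, hπeq⟩ := exists_measurable_isProj hΘcompact hΘconvex ⟨_, hθstar⟩
  let ℱ := pastFiltration W hW
  have hmeas : ∀ n, Measurable[ℱ n] (θ n) := by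
    intro n
    induction n with
    | zero =>
      rw [show θ 0 = fun _ => θ₀ from funext hθzero]
      exact measurable_const
    | succ n ih =>
      rw [show θ (n + 1) = fun ω => π (θ n ω - γ n • G (θ n ω) (W (n + 1) ω)) from
        funext fun ω => hπeq _ _ (hθsucc n ω)]
      have h1 : Measurable[ℱ (n + 1)] (θ n) := ih.mono (ℱ.mono n.le_succ) le_rfl
      have h2 : Measurable[ℱ (n + 1)] (W (n + 1)) := measurable_pastFiltration hW le_rfl
      exact hπ.comp (h1.sub ((hG.comp (h1.prodMk h2)).const_smul (γ n)))
  obtain ⟨R, hR⟩ := hΘcompact.isBounded.exists_norm_le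
  have hK0 : 0 ≤ K := (integral_nonneg fun w => by positivity).trans (hK _ hθstar)
  have key : ∀ᵐ ω ∂μ, Tendsto (fun n => ‖θ n ω - θstar‖ ^ 2) atTop (𝓝 0) := by
    refine ae_tendsto_zero_of_setIntegral_succ_le (ℱ := ℱ) (C := (R + R) ^ 2) (γ := γ)
      (ε := fun n => K * γ n ^ 2) (c := 2 * c)
      (fun n => ?_) (fun n ω => by positivity) (fun n ω => ?_) hγpos
      (fun n => by positivity) hγsum (hγsq.mul_left K) (by positivity) fun n A hA => ?_
    · have h := hmeas n
      exact Measurable.stronglyMeasurable (by fun_prop)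
    · have := norm_sub_le (θ n ω) θstar
      have := hR _ (hmem n ω)
      have := hR _ hθstar
      gcongr
      linarith
    · have hθm : ∀ n, Measurable (θ n) := fun n => (hmeas n).mono (ℱ.le n) le_rfl
      have hAm : MeasurableSet A := ℱ.le n A hA
      have hbound : ∀ k ω, ‖‖θ k ω - θstar‖ ^ 2‖ ≤ (R + R) ^ 2 := fun k ω => by
        rw [Real.norm_of_nonneg (by positivity)]
        have := norm_sub_le (θ k ω) θstar
        have := hR _ (hmem k ω)
        have := hR _ hθstar
        gcongr
        linarith
      have hint : ∀ k, Integrable (fun ω => ‖θ k ω - θstar‖ ^ 2) μ := fun k =>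
        Integrable.of_bound (by have := hθm k; fun_prop) _ (ae_of_all _ (hbound k))
      have hloc := fun ω => lintegral_norm_sub_smul_sq_le (hG2 _ (hmem n ω)) (hK _ (hmem n ω))
        (hmono _ (hmem n ω)) (hγpos n)
      -- The indicator of `A` is frozen together with `θ n`, so that the freezing lemma applies to
      -- an integral over `A`.
      have hX : Measurable[ℱ n] (fun ω => (θ n ω, A.indicator (fun _ => (1 : ℝ≥0∞)) ω)) :=
        (hmeas n).prodMk (measurable_const.indicator hA)
      have hfub := lintegral_comp_of_indepFun (hX.mono (ℱ.le n) le_rfl) (hW (n + 1))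
        (indepFun_of_measurable_pastFiltration hW hind hX)
        (g := fun z w => z.2 * ENNReal.ofReal (‖(z.1 - θstar) - γ n • G z.1 w‖ ^ 2)) (by
          have h1 : Measurable (fun z : (E q × ℝ≥0∞) × S => G z.1.1 z.2) :=
            hG.comp ((measurable_fst.comp measurable_fst).prodMk measurable_snd)
          unfold Function.uncurry
          fun_prop)
      have hI : Integrable (fun ω => ‖θ n ω - θstar‖ ^ 2
          - 2 * c * γ n * ‖θ n ω - θstar‖ ^ 2 + K * γ n ^ 2) μ :=
        ((hint n).sub ((hint n).const_mul _)).add (integrable_const _)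
      have hle : ∫⁻ ω in A, ENNReal.ofReal (‖θ (n + 1) ω - θstar‖ ^ 2) ∂μ ≤
          ∫⁻ ω in A, ENNReal.ofReal (‖θ n ω - θstar‖ ^ 2
            - 2 * c * γ n * ‖θ n ω - θstar‖ ^ 2 + K * γ n ^ 2) ∂μ := by
        rw [← lintegral_indicator hAm, ← lintegral_indicator hAm]
        calc _ ≤ ∫⁻ ω, A.indicator (fun _ => (1 : ℝ≥0∞)) ω * ENNReal.ofReal
              (‖(θ n ω - θstar) - γ n • G (θ n ω) (W (n + 1) ω)‖ ^ 2) ∂μ := by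
              refine lintegral_mono fun ω => ?_
              by_cases hω : ω ∈ A
              · simp only [Set.indicator_of_mem hω, one_mul]
                refine ENNReal.ofReal_le_ofReal ?_
                -- The point `θstar` is its own projection, so projecting does not increase the
                -- distance to it.
                have := (hθsucc n ω).norm_sub_le hΘconvex (isProj_self hθstar)
                rw [sub_right_comm] at this
                gcongr
              · simp [Set.indicator_of_notMem hω]
          _ = _ := hfub
          _ ≤ _ := by
              refine lintegral_mono fun ω => ?_
              by_cases hω : ω ∈ A
              · simp only [Set.indicator_of_mem hω, one_mul, hlaw]
                exact (hloc ω).2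
              · simp [Set.indicator_of_notMem hω]
      rw [← ofReal_integral_eq_lintegral_ofReal (hint _).integrableOn
          (ae_of_all _ fun ω => by positivity),
        ← ofReal_integral_eq_lintegral_ofReal hI.integrableOn
          (ae_of_all _ fun ω => (hloc ω).1)] at hle
      exact (ENNReal.ofReal_le_ofReal_iff (integral_nonneg fun ω => (hloc ω).1)).1 hle
  filter_upwards [key] with ω h
  rw [tendsto_iff_norm_sub_tendsto_zero]
  have := h.sqrt
  simpa using this

end RobbinsMonro

/-! ### Exponential moments of Brownian motion -/

section BrownianMoments

variable {Ω : Type*} {mΩ : MeasurableSpace Ω} {q : ℕ} {μ : Measure Ω}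
  {ℱ : Filtration ℝ≥0 mΩ} {B : ℝ≥0 → Ω → E q}

/-- Fernique's theorem makes `exp(C‖x‖²)` integrable for some `C > 0`; completing the square
dominates `exp(a‖x‖)` by a multiple of it. -/
theorem integrable_exp_mul_norm_of_isGaussian (ν : Measure (E q)) [IsGaussian ν] (a : ℝ) :
    Integrable (fun x => Real.exp (a * ‖x‖)) ν := by
  obtain ⟨C, hC, hint⟩ := IsGaussian.exists_integrable_exp_sq ν
  refine (hint.const_mul (Real.exp (a ^ 2 / (4 * C)))).mono'
    (by fun_prop) (ae_of_all _ fun x => ?_)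
  rw [Real.norm_of_nonneg (Real.exp_pos _).le, ← Real.exp_add, Real.exp_le_exp]
  have h1 : a ^ 2 / (4 * C) + C * ‖x‖ ^ 2 - a * ‖x‖ = (a - 2 * C * ‖x‖) ^ 2 / (4 * C) := by
    field_simp
    ring
  have h2 : 0 ≤ (a - 2 * C * ‖x‖) ^ 2 / (4 * C) := by positivity
  linarith

theorem IsBrownianMotion.measurable (hB : IsBrownianMotion μ ℱ B) (t : ℝ≥0) :
    Measurable (B t) :=
  ((hB.adapted t).mono (ℱ.le t)).measurable

theorem IsBrownianMotion.integrable_exp_mul_norm (hB : IsBrownianMotion μ ℱ B) (t : ℝ≥0)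
    (a : ℝ) : Integrable (fun ω => Real.exp (a * ‖B t ω‖)) μ := by
  have hae : (fun ω => B t ω - B 0 ω) =ᵐ[μ] B t := by
    filter_upwards [hB.start] with ω h
    rw [h, sub_zero]
  have hlaw : μ.map (B t) = (stdGaussian (E q)).map
      ((Real.sqrt t) • ContinuousLinearMap.id ℝ (E q)) := by
    rw [← Measure.map_congr hae, hB.law 0 t t.2]
    simp
    rfl
  have : IsGaussian (μ.map (B t)) := by rw [hlaw]; infer_instance
  exact (integrable_exp_mul_norm_of_isGaussian (μ.map (B t)) a).comp_measurable (hB.measurable t)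

theorem IsBrownianMotion.memLp_exp_mul_norm_add (hB : IsBrownianMotion μ ℱ B) (t : ℝ≥0)
    (a b : ℝ) {s : ℝ} (hs : 0 < s) :
    MemLp (fun ω => Real.exp (a * ‖B t ω‖ + b)) (ENNReal.ofReal s) μ := by
  have hm : AEStronglyMeasurable (fun ω => Real.exp (a * ‖B t ω‖ + b)) μ := by
    have := hB.measurable t
    fun_prop
  rw [← integrable_norm_rpow_iff hm (by simpa using hs) ENNReal.ofReal_ne_top,
    ENNReal.toReal_ofReal hs.le]
  refine ((hB.integrable_exp_mul_norm t (a * s)).const_mul (Real.exp (b * s))).congr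
    (ae_of_all _ fun ω => ?_)
  dsimp only
  rw [Real.norm_of_nonneg (Real.exp_pos _).le, ← Real.exp_mul, ← Real.exp_add]
  ring_nf

end BrownianMoments

namespace Setting

variable {d q : ℕ} {A : Setting d q}

/-! ### Measurability of the scheme and of the estimator -/

section Measurability

theorem measurable_state (hA : A.Admissible) (h : ℝ≥0) (k : ℕ) :
    Measurable (fun w : ℝ≥0 → E q => A.state h w k) := by
  induction k with
  | zero => exact measurable_const
  | succ k ih =>
    have h1 : Measurable (fun (w : ℝ≥0 → E q) (s : ℝ≥0) =>
        w (k * h + min s h) - w (k * h)) :=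
      measurable_pi_lambda _ fun s => (measurable_pi_apply _).sub (measurable_pi_apply _)
    exact (hA.step_meas h).comp (ih.prodMk h1)

theorem measurable_approxPayoff (hA : A.Admissible) (n : ℕ) : Measurable (A.approxPayoff n) :=
  hA.P_meas.comp (measurable_state hA _ _)

theorem measurable_Z (hA : A.Admissible) (l : ℕ) : Measurable (A.Z l) := by
  unfold Z
  split_ifs
  · exact measurable_approxPayoff hA 1
  · exact (measurable_approxPayoff hA _).sub (measurable_approxPayoff hA _)

theorem measurable_weightedSq (hA : A.Admissible) (varP : ℝ) (l : ℕ) :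
    Measurable (A.weightedSq varP l) := by
  have := measurable_Z hA
  unfold weightedSq Y
  split_ifs <;> fun_prop

theorem continuous_Jplus : Continuous (Function.uncurry A.Jplus) := by
  unfold Jplus Function.uncurry
  fun_prop

theorem measurable_Jplus_eval (θ : E q) :
    Measurable (fun w : ℝ≥0 → E q => A.Jplus (w A.T) θ) := by
  have hT : Measurable (fun w : ℝ≥0 → E q => w A.T) := measurable_pi_apply _
  exact (continuous_Jplus (A := A)).measurable.comp (hT.prodMk measurable_const)

theorem measurable_G (hA : A.Admissible) (varP : ℝ) (l : ℕ) :
    Measurable (Function.uncurry (A.G varP l)) := by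
  have h1 := measurable_weightedSq hA varP l
  have hT : Measurable (fun w : ℝ≥0 → E q => w A.T) := measurable_pi_apply _
  have h2 : Measurable (fun z : E q × (ℝ≥0 → E q) => A.Jplus (z.2 A.T) z.1) :=
    (continuous_Jplus (A := A)).measurable.comp
      ((hT.comp measurable_snd).prodMk measurable_fst)
  unfold G Function.uncurry
  fun_prop

end Measurability

/-! ### Positivity of the level coefficients -/

section Coefficients

theorem bigh_pos (hA : A.Admissible) : 0 < A.bigh :=
  div_pos hA.T_pos (Nat.cast_pos.2 hA.N₀_pos)

theorem M_pos (hA : A.Admissible) : (0 : ℝ) < A.M :=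
  Nat.cast_pos.2 (zero_lt_two.trans_le hA.two_le_M)

theorem CUp_pos (hA : A.Admissible) : 0 < A.CUp := by
  have := M_pos hA
  unfold CUp
  positivity

theorem CLow_pos (hA : A.Admissible) : 0 < A.CLow := by
  have := M_pos hA
  unfold CLow
  positivity

/-- For `β > 1` the ratio `M^((1-β)/2)` is below one, so the denominator in `bigSigma` is positive.
-/
theorem bigSigma_pos (hA : A.Admissible) (hβ : 1 < A.β) (varP : ℝ) : 0 < A.bigSigma varP := by
  have hM : (1 : ℝ) < A.M := Nat.one_lt_cast.2 hA.two_le_M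
  have h1 : (A.M : ℝ) ^ ((1 - A.β) / 2) < 1 := Real.rpow_lt_one_of_one_lt_of_neg hM (by linarith)
  have h2 : 0 < 1 - (A.M : ℝ) ^ ((1 - A.β) / 2) := sub_pos.2 h1
  have := M_pos hA
  have := bigh_pos hA
  have := CUp_pos hA
  have : 0 ≤ A.lam varP := Real.sqrt_nonneg _
  unfold bigSigma
  positivity

theorem k_pos (hA : A.Admissible) (hβ : 1 < A.β) {varP : ℝ} (hvar : 0 < varP) {l : ℕ}
    (hl : 1 ≤ l) (hW : 2 ≤ l → A.bigW l ≠ 0) : 0 < A.k varP l := by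
  have := M_pos hA
  have := bigh_pos hA
  have := CLow_pos hA
  have := bigSigma_pos hA hβ varP
  have := hA.V₁_pos
  have : 0 ≤ A.lam varP := Real.sqrt_nonneg _
  unfold k
  split_ifs with h
  · unfold kOne
    positivity
  · have := abs_pos.2 (hW (by omega))
    unfold kTwo
    positivity

/-- Merges the regimes `β > 1` and `β ≤ 1`: from here on only the existence of a positive factor `κ`
matters. -/
theorem exists_weightedSq_eq (hA : A.Admissible) {varP : ℝ} (hvar : 1 < A.β → 0 < varP) {l : ℕ}
    (hl : 1 ≤ l) (hW : 1 < A.β → 2 ≤ l → A.bigW l ≠ 0) :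
    ∃ κ : ℝ, 0 < κ ∧ ∀ w, A.weightedSq varP l w = κ * A.Z l w ^ 2 := by
  by_cases hβ : 1 < A.β
  · exact ⟨A.k varP l, k_pos hA hβ (hvar hβ) hl (hW hβ), fun w => by simp [weightedSq, hβ]⟩
  · by_cases h1 : l = 1
    · exact ⟨1, one_pos, fun w => by simp [weightedSq, hβ, Y, h1]⟩
    · have := M_pos hA
      have := bigh_pos hA
      refine ⟨((A.bigh / (A.M : ℝ) ^ (l - 1)) ^ (-A.β / 2)) ^ 2, by positivity, fun w => ?_⟩
      simp only [weightedSq, hβ, Y, h1, if_false, mul_pow]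

end Coefficients

/-! ### Moments of the level differences -/

section Integrability

variable {Ω : Type*} {mΩ : MeasurableSpace Ω} {μ : Measure Ω}
  {B : ℝ≥0 → Ω → E q}

theorem StrongError.memLp (hA : A.Admissible) (hBm : ∀ t, Measurable (B t)) {XT : Ω → E d}
    (hX : Measurable XT) {p V : ℝ} (hp : 0 < p) (h : A.StrongError μ B XT p V) {n : ℕ}
    (hn : 1 ≤ n) :
    MemLp (fun ω => A.approxPayoff n (fun t => B t ω) - A.P (XT ω)) (ENNReal.ofReal p) μ := by
  have hm : Measurable (fun ω => A.approxPayoff n (fun t => B t ω) - A.P (XT ω)) :=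
    ((measurable_approxPayoff hA n).comp (measurable_pi_lambda _ hBm)).sub (hA.P_meas.comp hX)
  refine ⟨hm.aestronglyMeasurable, ?_⟩
  rw [eLpNorm_lt_top_iff_lintegral_rpow_enorm_lt_top (by simpa using hp) ENNReal.ofReal_ne_top,
    ENNReal.toReal_ofReal hp.le]
  refine lt_of_eq_of_lt (lintegral_congr fun ω => ?_) ((h n hn).trans_lt ENNReal.ofReal_lt_top)
  rw [← ofReal_norm, ENNReal.ofReal_rpow_of_nonneg (norm_nonneg _) hp.le, Real.norm_eq_abs]

/-- For `l ≠ 1` the exact payoff cancels in the difference of two strong errors. -/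
theorem memLp_Z (hA : A.Admissible) (hBm : ∀ t, Measurable (B t)) {XT : Ω → E d}
    (hX : Measurable XT) {p V : ℝ} (hp : 0 < p) (h : A.StrongError μ B XT p V) {l : ℕ}
    (hZ₁ : l = 1 → MemLp (fun ω => A.Z 1 (fun t => B t ω)) (ENNReal.ofReal p) μ) :
    MemLp (fun ω => A.Z l (fun t => B t ω)) (ENNReal.ofReal p) μ := by
  by_cases h1 : l = 1
  · subst h1; exact hZ₁ rfl
  · have hM : ∀ j, 1 ≤ A.M ^ j := fun j =>
      Nat.one_le_pow _ _ (zero_lt_two.trans_le hA.two_le_M)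
    convert (h.memLp hA hBm hX hp (hM (l - 1))).sub (h.memLp hA hBm hX hp (hM (l - 2))) using 2
    simp [Z, h1]

theorem memLp_Z_sq_mul_exp [IsProbabilityMeasure μ] {ℱ : Filtration ℝ≥0 mΩ}
    (hB : IsBrownianMotion μ ℱ B) {p : ℝ} (hp : 4 < p) {l : ℕ}
    (hZ : MemLp (fun ω => A.Z l (fun t => B t ω)) (ENNReal.ofReal p) μ) (t : ℝ≥0) (a b : ℝ) :
    MemLp (fun ω => A.Z l (fun t => B t ω) ^ 2 * Real.exp (a * ‖B t ω‖ + b)) 2 μ := by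
  have hs : 0 < 4 * p / (p - 4) := div_pos (by linarith) (by linarith)
  have hH := hB.memLp_exp_mul_norm_add t a b hs
  -- The exponent `s = 4p/(p - 4)` solves `1/s + 1/p = 1/4`; it exists because `p > 4`. Thus `exp ·
  -- Z` is in `L⁴`, and multiplying by the second factor `Z` in `L⁴` lands in `L²`.
  have hpqr : ENNReal.HolderTriple (ENNReal.ofReal (4 * p / (p - 4))) (ENNReal.ofReal p) 4 := by
    constructor
    have h4 : (4 : ℝ≥0∞) = ENNReal.ofReal 4 := by norm_num
    rw [h4, ← ENNReal.ofReal_inv_of_pos hs, ← ENNReal.ofReal_inv_of_pos (by linarith),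
      ← ENNReal.ofReal_inv_of_pos (by norm_num),
      ← ENNReal.ofReal_add (by positivity) (inv_nonneg.2 (by linarith))]
    congr 1
    have : p - 4 ≠ 0 := by linarith
    have : p ≠ 0 := by linarith
    field_simp
    ring
  have h442 : ENNReal.HolderTriple 4 4 2 := by
    constructor
    have h4 : (4 : ℝ≥0∞) = ENNReal.ofReal 4 := by norm_num
    have h2 : (2 : ℝ≥0∞) = ENNReal.ofReal 2 := by norm_num
    rw [h4, h2, ← ENNReal.ofReal_inv_of_pos (by norm_num),
      ← ENNReal.ofReal_inv_of_pos (by norm_num), ← ENNReal.ofReal_add (by norm_num) (by norm_num)]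
    norm_num
  have hZ4 : MemLp (fun ω => A.Z l (fun t => B t ω)) 4 μ := by
    refine hZ.mono_exponent ?_
    rw [show (4 : ℝ≥0∞) = ENNReal.ofReal 4 by norm_num]
    exact ENNReal.ofReal_le_ofReal hp.le
  have hZH : MemLp ((fun ω => Real.exp (a * ‖B t ω‖ + b)) * fun ω => A.Z l (fun t => B t ω)) 4 μ :=
    hZ.mul hH
  have hprod := MemLp.mul (r := 2) hZ4 hZH
  convert hprod using 2
  simp only [Pi.mul_apply]
  ring

end Integrability

/-! ### Envelopes and convexity of `J⁺` -/

section Estimates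

theorem Jplus_pos (x θ : E q) : 0 < A.Jplus x θ := Real.exp_pos _

theorem Jplus_le {R : ℝ} {θ : E q} (hθ : ‖θ‖ ≤ R) (x : E q) :
    A.Jplus x θ ≤ Real.exp (R * ‖x‖ + R ^ 2 * A.T) := by
  unfold Jplus
  rw [Real.exp_le_exp]
  have h1 := neg_le_of_abs_le (abs_real_inner_le_norm θ x)
  have h2 : ‖θ‖ * ‖x‖ ≤ R * ‖x‖ := by gcongr
  have h3 : ‖θ‖ ^ 2 * A.T ≤ R ^ 2 * A.T := by gcongr
  have h4 : 0 ≤ ‖θ‖ ^ 2 * A.T := by positivity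
  linarith

theorem Jplus_le_exp_add_one_mul {R : ℝ} {θ : E q} (hθ : ‖θ‖ ≤ R) (x : E q) :
    A.Jplus x θ ≤ Real.exp ((R + 1) * ‖x‖ + (R ^ 2 + R) * A.T) := by
  refine (Jplus_le hθ x).trans (Real.exp_le_exp.2 ?_)
  have := norm_nonneg x
  have : 0 ≤ R * A.T := mul_nonneg ((norm_nonneg _).trans hθ) A.T.2
  linarith

/-- The linear factor is absorbed through `y ≤ exp y` with `y = ‖x‖ + R T`; this adds `1` to the
coefficient of `‖x‖` and `R` to that of `T`. -/
theorem norm_Jplus_smul_le {R : ℝ} {θ : E q} (hθ : ‖θ‖ ≤ R) (x : E q) :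
    ‖A.Jplus x θ • ((A.T : ℝ) • θ - x)‖ ≤
      Real.exp ((R + 1) * ‖x‖ + (R ^ 2 + R) * A.T) := by
  have h0 : 0 ≤ A.Jplus x θ := (Jplus_pos x θ).le
  have h1 : ‖(A.T : ℝ) • θ - x‖ ≤ Real.exp (‖x‖ + R * A.T) := by
    refine (norm_sub_le _ _).trans ?_
    rw [norm_smul, Real.norm_of_nonneg (NNReal.coe_nonneg A.T)]
    have h2 : (A.T : ℝ) * ‖θ‖ ≤ A.T * R := by gcongr
    have h3 := Real.add_one_le_exp (‖x‖ + R * A.T)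
    linarith
  rw [norm_smul, Real.norm_of_nonneg h0]
  calc _ ≤ Real.exp (R * ‖x‖ + R ^ 2 * A.T) * Real.exp (‖x‖ + R * A.T) := by
        gcongr
        exact Jplus_le hθ x
    _ = _ := by rw [← Real.exp_add]; ring_nf

/-- Strong convexity of `θ ↦ J⁺(x, θ)`. -/
theorem Jplus_add_inner_le (x θ θ' : E q) :
    A.Jplus x θ * (1 + A.T / 2 * ‖θ' - θ‖ ^ 2)
      + inner ℝ (θ' - θ) (A.Jplus x θ • ((A.T : ℝ) • θ - x)) ≤ A.Jplus x θ' := by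
  -- An exact identity, since the exponent of `J⁺` is quadratic in `θ`; the bound `u + 1 ≤ exp u`
  -- then suffices.
  have h1 : A.Jplus x θ' = A.Jplus x θ *
      Real.exp (inner ℝ (θ' - θ) ((A.T : ℝ) • θ - x) + A.T / 2 * ‖θ' - θ‖ ^ 2) := by
    unfold Jplus
    rw [← Real.exp_add]
    congr 1
    rw [norm_sub_sq_real]
    simp only [inner_sub_left, inner_sub_right, inner_smul_right, real_inner_self_eq_norm_sq]
    ring
  have h2 := Real.add_one_le_exp
    (inner ℝ (θ' - θ) ((A.T : ℝ) • θ - x) + A.T / 2 * ‖θ' - θ‖ ^ 2)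
  have h0 : 0 ≤ A.Jplus x θ := (Jplus_pos x θ).le
  rw [h1, inner_smul_right]
  nlinarith [mul_le_mul_of_nonneg_left h2 h0]

end Estimates

end Setting

end ML2R

/-! ### Strong monotonicity of the mean field and conclusion -/

theorem theorem3 {d q : ℕ} (A : ML2R.Setting d q) (hA : A.Admissible)
    -- the Brownian motion `B` and the solution `X` of the stochastic differential equation
    {Ω : Type*} [mΩ : MeasurableSpace Ω] (μ : Measure Ω) [IsProbabilityMeasure μ]
    (ℱ : Filtration ℝ≥0 mΩ) (B : ℝ≥0 → Ω → ML2R.E q) (hB : ML2R.IsBrownianMotion μ ℱ B)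
    (X : ℝ≥0 → Ω → ML2R.E d) (hX : ML2R.IsSDESolution μ ℱ A.b A.σ A.x₀ A.T B X)
    (varP : ℝ) (hvarP : varP = variance (fun ω => A.P (X A.T ω)) μ)
    -- the level
    (l : ℕ) (hl : 1 ≤ l) (hlL : l ≤ A.L)
    -- the coefficients `k_l` are well defined and nonzero
    (hP : 1 < A.β → MemLp (fun ω => A.P (X A.T ω)) 2 μ ∧ 0 < varP)
    (hW : 1 < A.β → 2 ≤ l → A.bigW l ≠ 0)
    -- strong errors and integrability
    (hSE₂ : A.StrongError μ B (X A.T) 2 A.V₁)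
    (p : ℝ) (hp : 4 < p) (hSE : ∃ V : ℝ, 0 < V ∧ A.StrongError μ B (X A.T) p V)
    (hZ₁ : l = 1 → MemLp (fun ω => A.Z 1 (fun t => B t ω)) (ENNReal.ofReal p) μ)
    -- nondegeneracy
    (hZ : 0 < μ {ω | A.Z l (fun t => B t ω) ≠ 0})
    -- the independent copies of `B` that drive the algorithm
    {Ω' : Type*} [MeasurableSpace Ω'] (μ' : Measure Ω') [IsProbabilityMeasure μ']
    (W : ℕ → ℝ≥0 → Ω' → ML2R.E q) (hWmeas : ∀ n t, Measurable (W n t))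
    (hWcopy : ∀ n, IdentDistrib (fun ω t => W n t ω) (fun ω t => B t ω) μ' μ)
    (hWindep : iIndepFun (fun n ω t => W n t ω) μ')
    -- the step sizes
    (γ : ℕ → ℝ) (hγpos : ∀ n, 1 ≤ n → 0 < γ n) (hγdec : ∀ n, 1 ≤ n → γ (n + 1) ≤ γ n)
    (hγsum : ¬ Summable (fun n => γ (n + 1))) (hγsq : Summable (fun n => γ (n + 1) ^ 2))
    -- the constraint set and the projected Robbins-Monro iterates
    (Θ : Set (ML2R.E q)) (hΘcompact : IsCompact Θ) (hΘconvex : Convex ℝ Θ)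
    (θ : ℕ → Ω' → ML2R.E q) (θ₀ : ML2R.E q) (hθ₀ : θ₀ ∈ Θ) (hθzero : ∀ ω, θ 0 ω = θ₀)
    (hθsucc : ∀ n ω, ML2R.IsProj Θ
      (θ n ω - γ (n + 1) • A.G varP l (θ n ω) (fun t => W (n + 1) t ω)) (θ (n + 1) ω))
    -- the minimizer
    (θstar : ML2R.E q) (hmin : ∀ ϑ, A.v μ B varP l θstar ≤ A.v μ B varP l ϑ)
    (hgrad : HasGradientAt (A.v μ B varP l) 0 θstar) (hθstar : θstar ∈ Θ) :
    ∀ᵐ ω ∂μ', Tendsto (fun n => θ n ω) atTop (𝓝 θstar) := by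
  have hpath : Measurable (fun ω t => B t ω) := measurable_pi_lambda _ hB.measurable
  have hXT : Measurable (X A.T) := ((hX.adapted A.T).mono (ℱ.le _)).measurable
  have hν : IsProbabilityMeasure (μ.map fun ω t => B t ω) :=
    Measure.isProbabilityMeasure_map hpath.aemeasurable
  obtain ⟨V, -, hSEV⟩ := hSE
  have hZp := ML2R.Setting.memLp_Z hA hB.measurable hXT (by linarith) hSEV hZ₁
  obtain ⟨κ, hκ, hQ⟩ := ML2R.Setting.exists_weightedSq_eq hA (fun h => (hP h).2) hl hW
  have hQ0 : ∀ w, 0 ≤ A.weightedSq varP l w := fun w => by rw [hQ]; positivity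
  have hQm := ML2R.Setting.measurable_weightedSq hA varP l
  have hGm := ML2R.Setting.measurable_G hA varP l
  obtain ⟨R, hR⟩ := hΘcompact.isBounded.exists_norm_le
  -- a square integrable envelope of `G` over `Θ`
  set D : (ℝ≥0 → ML2R.E q) → ℝ := fun w => A.weightedSq varP l w *
    Real.exp ((R + 1) * ‖w A.T‖ + (R ^ 2 + R) * A.T) with hD
  have hT : Measurable (fun w : ℝ≥0 → ML2R.E q => w A.T) := measurable_pi_apply _
  have hDm : Measurable D := by fun_prop
  have hD2 : MemLp D 2 (μ.map fun ω t => B t ω) := by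
    rw [memLp_map_measure_iff hDm.aestronglyMeasurable hpath.aemeasurable]
    convert (ML2R.Setting.memLp_Z_sq_mul_exp hB hp hZp A.T (R + 1)
      ((R ^ 2 + R) * A.T)).const_mul κ using 2 with ω
    simp [hD, hQ, mul_assoc]
  have hD0 : ∀ w, 0 ≤ D w := fun w => mul_nonneg (hQ0 w) (Real.exp_pos _).le
  have hGD : ∀ ϑ ∈ Θ, ∀ w, ‖A.G varP l ϑ w‖ ≤ D w := fun ϑ hϑ w => by
    rw [ML2R.Setting.G, mul_smul, norm_smul, Real.norm_of_nonneg (hQ0 w)]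
    exact mul_le_mul_of_nonneg_left (ML2R.Setting.norm_Jplus_smul_le (hR _ hϑ) _) (hQ0 w)
  have hGϑm : ∀ ϑ, Measurable (A.G varP l ϑ) := fun ϑ =>
    hGm.of_uncurry_left (x := ϑ)
  have hG2 : ∀ ϑ ∈ Θ, MemLp (A.G varP l ϑ) 2 (μ.map fun ω t => B t ω) := fun ϑ hϑ =>
    hD2.mono (hGϑm ϑ).aestronglyMeasurable
      (ae_of_all _ fun w => by rw [Real.norm_of_nonneg (hD0 w)]; exact hGD ϑ hϑ w)
  have hJm : ∀ ϑ, Measurable (fun w : ℝ≥0 → ML2R.E q => A.Jplus (w A.T) ϑ) := 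
    ML2R.Setting.measurable_Jplus_eval
  have hQJm : ∀ ϑ, Measurable (fun w => A.weightedSq varP l w * A.Jplus (w A.T) ϑ) := fun ϑ =>
    hQm.mul (hJm ϑ)
  have hQJ : ∀ ϑ ∈ Θ, Integrable (fun w => A.weightedSq varP l w * A.Jplus (w A.T) ϑ)
      (μ.map fun ω t => B t ω) := fun ϑ hϑ => by
    refine (hD2.integrable (by norm_num)).mono' (hQJm ϑ).aestronglyMeasurable
      (ae_of_all _ fun w => ?_)
    rw [Real.norm_of_nonneg (mul_nonneg (hQ0 w) (ML2R.Setting.Jplus_pos _ _).le)]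
    exact mul_le_mul_of_nonneg_left (ML2R.Setting.Jplus_le_exp_add_one_mul (hR _ hϑ) _) (hQ0 w)
  -- Everything is moved to path space under the law of `B`, which is also the law of each driving
  -- path.
  have hv : ∀ ϑ, A.v μ B varP l ϑ =
      ∫ w, A.weightedSq varP l w * A.Jplus (w A.T) ϑ ∂(μ.map fun ω t => B t ω) := fun ϑ =>
    (integral_map hpath.aemeasurable (hQJm ϑ).aestronglyMeasurable).symm
  have hTpos : (0 : ℝ) < A.T := hA.T_pos
  -- the minimal value is positive
  have hvpos : 0 < A.v μ B varP l θstar := by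
    have hi := (hQJ θstar hθstar).comp_measurable hpath
    have hi0 : ∀ ω, 0 ≤ A.weightedSq varP l (fun t => B t ω) * A.Jplus (B A.T ω) θstar :=
      fun ω => mul_nonneg (hQ0 _) (ML2R.Setting.Jplus_pos _ _).le
    rw [ML2R.Setting.v, integral_pos_iff_support_of_nonneg hi0 hi]
    -- The integrand `κ Z² J⁺` is nonzero wherever `Z` is.
    refine hZ.trans_le (measure_mono fun ω hω => ?_)
    rw [Function.mem_support, hQ]
    exact mul_ne_zero (mul_ne_zero hκ.ne' (pow_ne_zero 2 hω)) (ML2R.Setting.Jplus_pos _ _).ne'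
  have hK : ∀ ϑ ∈ Θ, ∫ w, ‖A.G varP l ϑ w‖ ^ 2 ∂(μ.map fun ω t => B t ω) ≤
      ∫ w, D w ^ 2 ∂(μ.map fun ω t => B t ω) := fun ϑ hϑ => by
    refine integral_mono (hG2 ϑ hϑ).norm.integrable_sq hD2.integrable_sq fun w => ?_
    have := hGD ϑ hϑ w
    dsimp only
    gcongr
  -- Convexity is applied from `ϑ` towards `θstar`, so the estimator appears at `ϑ`; minimality then
  -- replaces `v(ϑ)` by `v(θstar)`.
  have hmono : ∀ ϑ ∈ Θ, A.T / 2 * A.v μ B varP l θstar * ‖ϑ - θstar‖ ^ 2 ≤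
      inner ℝ (ϑ - θstar) (∫ w, A.G varP l ϑ w ∂(μ.map fun ω t => B t ω)) := fun ϑ hϑ => by
    have hGi : Integrable (A.G varP l ϑ) (μ.map fun ω t => B t ω) :=
      (hG2 ϑ hϑ).integrable (by norm_num)
    have hmono : A.v μ B varP l ϑ * (1 + A.T / 2 * ‖θstar - ϑ‖ ^ 2)
        + inner ℝ (θstar - ϑ) (∫ w, A.G varP l ϑ w ∂(μ.map fun ω t => B t ω))
        ≤ A.v μ B varP l θstar := by
      rw [hv, hv, ← integral_inner hGi, ← integral_mul_const,
        ← integral_add ((hQJ ϑ hϑ).mul_const _) (hGi.const_inner _)]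
      refine integral_mono (((hQJ ϑ hϑ).mul_const _).add (hGi.const_inner _)) (hQJ _ hθstar)
        fun w => ?_
      have := mul_le_mul_of_nonneg_left
        (ML2R.Setting.Jplus_add_inner_le (A := A) (w A.T) ϑ θstar) (hQ0 w)
      dsimp only
      rw [ML2R.Setting.G, mul_smul, inner_smul_right]
      linarith
    have hle := hmin ϑ
    rw [← neg_sub ϑ θstar, inner_neg_left, norm_neg] at hmono
    have : A.T / 2 * ‖ϑ - θstar‖ ^ 2 * A.v μ B varP l θstar
        ≤ A.T / 2 * ‖ϑ - θstar‖ ^ 2 * A.v μ B varP l ϑ := by gcongr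
    linarith
  have hc : 0 < A.T / 2 * A.v μ B varP l θstar := by positivity
  have hWpath : ∀ n, Measurable (fun ω t => W n t ω) := fun n =>
    measurable_pi_lambda _ (hWmeas n)
  exact ML2R.ae_tendsto_projected_robbinsMonro (G := A.G varP l)
    (W := fun n ω t => W n t ω) (γ := fun n => γ (n + 1)) (θ := θ) hGm hΘcompact hΘconvex
    hθstar hG2 hK hc hmono hWpath (fun n => (hWcopy n).map_eq) hWindep
    (fun n => hγpos (n + 1) (by omega)) hγsum hγsq hθ₀ hθzero hθsucc
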